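/- For every $\beta_0>1$ there are constants $C''_{\beta_0}>C'_{\beta_0}>0$, depending on $\beta_0$ only, such that the following holds. Let $n\ge 1$, let $\beta\ge n+1$ and $\beta\ge\beta_0 n$, and let $X$ be a random vector in $\mathbb{R}^n$ with a density of the form $f=V^{-\beta}$ on a convex set $S\subset\mathbb{R}^n$ and $f=0$ outside $S$, where $V$ is a positive convex function on $S$. Then the entropy $h(X)=-\int_{\mathbb{R}^n} f(x)\log f(x)\,dx$ exists as a Lebesgue integral and is finite, and the entropy power $H(X)=e^{2h(X)/n}$ satisfies $$C'_{\beta_0}\,|K_f|^{2/n}\ \le\ H(X)\ \le\ C''_{\beta_0}\,|K_f|^{2/n}.$$ Here $|\cdot|$ is Lebesgue measure on $\mathbb{R}^n$, and $$K_f=\{x\in\mathbb{R}^n:\ f(x)\ge c_0^{\,n}\,\|f\|\},\qquad \|f\|=\operatorname{ess\,sup}_x f(x),\qquad c_0=\exp\{-32\beta_0/(\beta_0-1)\},$$ is the essential support of the distribution of $X$, which has finite volume. -/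

import Mathlib

open MeasureTheory Set

noncomputable section

/-- The density that equals `V ^ (-β)` on the supporting set `S` and vanishes outside `S`. -/
def convexDensity {E : Type*} (S : Set E) (V : E → ℝ) (β : ℝ) : E → ℝ :=
  S.indicator fun x => V x ^ (-β)

/-- The random vector `X` has density `f` with respect to Lebesgue measure. -/
def HasDensity {Ω : Type*} [MeasurableSpace Ω] {n : ℕ} (P : Measure Ω)
    (X : Ω → EuclideanSpace ℝ (Fin n)) (f : EuclideanSpace ℝ (Fin n) → ℝ) : Prop :=
  AEMeasurable X P ∧ P.map X = volume.withDensity fun x => ENNReal.ofReal (f x)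

/-- The integrand `-p log p` of the entropy, `p` being the density of the random vector `X`
(the Radon-Nikodym derivative of the law of `X` with respect to Lebesgue measure). -/
def entropyIntegrand {Ω : Type*} [MeasurableSpace Ω] {n : ℕ} (P : Measure Ω)
    (X : Ω → EuclideanSpace ℝ (Fin n)) (x : EuclideanSpace ℝ (Fin n)) : ℝ :=
  -((MeasureTheory.pdf X P volume x).toReal * Real.log (MeasureTheory.pdf X P volume x).toReal)

/-- The entropy `h(X)` exists in the Lebesgue sense, as a finite number. -/
def HasFiniteEntropy {Ω : Type*} [MeasurableSpace Ω] {n : ℕ} (P : Measure Ω)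
    (X : Ω → EuclideanSpace ℝ (Fin n)) : Prop :=
  Integrable (entropyIntegrand P X) volume

/-- The differential entropy `h(X) = -∫ p log p`. -/
def entropy {Ω : Type*} [MeasurableSpace Ω] {n : ℕ} (P : Measure Ω)
    (X : Ω → EuclideanSpace ℝ (Fin n)) : ℝ :=
  ∫ x, entropyIntegrand P X x

/-- The entropy power `H(X) = exp (2 h(X) / n)`. -/
def entropyPower {Ω : Type*} [MeasurableSpace Ω] {n : ℕ} (P : Measure Ω)
    (X : Ω → EuclideanSpace ℝ (Fin n)) : ℝ :=
  Real.exp (2 * entropy P X / n)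

/-- The constant `c₀ ∈ (0, 1)` of the essential support; it depends on `β₀` only. -/
def essConst (β₀ : ℝ) : ℝ :=
  Real.exp (-(32 * β₀ / (β₀ - 1)))

/-- The maximum `‖f‖ = ess sup f` of a nonnegative function, as an extended real. -/
def densityMax {n : ℕ} (f : EuclideanSpace ℝ (Fin n) → ℝ) : ENNReal :=
  essSup (fun x => ENNReal.ofReal (f x)) volume

/-- The essential support `K_f = {x : f x ≥ c₀ ^ n * ‖f‖}`. -/
def essentialSupport {n : ℕ} (β₀ : ℝ) (f : EuclideanSpace ℝ (Fin n) → ℝ) :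
    Set (EuclideanSpace ℝ (Fin n)) :=
  {x | ENNReal.ofReal (essConst β₀ ^ n) * densityMax f ≤ ENNReal.ofReal (f x)}

end

/-! Write `M = ‖f‖` and `κ = β₀ / (β₀ - 1)`. Both sides are compared with `M ^ (-2/n)`. Since `f ≤
M`, `h(X) ≥ -log M`; the substance is the reverse bound `h(X) ≤ -log M + 4 κ n`. Given it, a
Chebyshev argument for the nonnegative variable `log (M / f(X))` puts more than half the mass in
`K_f`, whence `1/2 ≤ M |K_f|`, while `∫ f = 1` gives `M c₀ⁿ |K_f| ≤ 1`.

The reverse bound comes from contracting the domain towards a point `x₀` with ratio `l`: convexity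
of `V` and the Jacobian `lⁿ` give `lintegral_homothety_le`. Its first-order form as `l → 1` is the
moment inequality `sub_finrank_mul_lintegral_le`; the case `l = 1/2` with Fatou shows that `m = inf
V` is positive (`exists_pos_lower_bound`). Applied with `a = β - 1/2` and `V x₀ → m`, the moment
inequality controls the mean of `(V / m) ^ (1/2)`, which dominates the mean of `log (V / m)` and
hence the entropy. -/

open Filter Topology Module

/-! ### Contractions of a convex domain and moment inequalities. -/

section Homothety

variable {E : Type*} [NormedAddCommGroup E] [NormedSpace ℝ E] [FiniteDimensional ℝ E]
  [MeasurableSpace E] [BorelSpace E] {μ : Measure E} [μ.IsAddHaarMeasure]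

/-- Contracting a convex set towards one of its points compares the integral of an antitone
function of a convex function `V` with that of an interpolated argument. -/
theorem lintegral_homothety_le {T : Set E} {V : E → ℝ} (hV : ConvexOn ℝ T V)
    (hT : MeasurableSet T) (hpos : ∀ x ∈ T, 0 < V x) {x₀ : E} (hx₀ : x₀ ∈ T) {l : ℝ}
    (hl : 0 < l) (hl1 : l ≤ 1) {g : ℝ → ENNReal} (hg : AntitoneOn g (Ioi 0)) :
    ENNReal.ofReal (l ^ finrank ℝ E) * ∫⁻ y in T, g ((1 - l) * V x₀ + l * V y) ∂μ
      ≤ ∫⁻ x in T, g (V x) ∂μ := by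
  set h : E → E := fun y => (1 - l) • x₀ + l • y with hh
  have hmem : ∀ y ∈ T, h y ∈ T := fun y hy =>
    hV.1 hx₀ hy (by linarith) hl.le (by ring)
  have hderiv : ∀ y ∈ T, HasFDerivWithinAt h (l • ContinuousLinearMap.id ℝ E) T y := fun y _ =>
    (((hasFDerivAt_id y).const_smul l).const_add _).hasFDerivWithinAt
  have hinj : InjOn h T := fun a _ b _ hab => by
    have : l • a = l • b := add_left_cancel hab
    exact smul_right_injective E hl.ne' this
  have key := lintegral_image_eq_lintegral_abs_det_fderiv_mul μ hT hderiv hinj (fun x => g (V x))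
  have hdet : ENNReal.ofReal |(l • ContinuousLinearMap.id ℝ E).det|
      = ENNReal.ofReal (l ^ finrank ℝ E) := by
    have : (l • ContinuousLinearMap.id ℝ E).det = l ^ finrank ℝ E := by
      simp [ContinuousLinearMap.det]
    rw [this, abs_of_pos (by positivity)]
  simp only [hdet] at key
  rw [← lintegral_const_mul' _ _ ENNReal.ofReal_ne_top]
  calc ∫⁻ y in T, ENNReal.ofReal (l ^ finrank ℝ E) * g ((1 - l) * V x₀ + l * V y) ∂μ
      ≤ ∫⁻ y in T, ENNReal.ofReal (l ^ finrank ℝ E) * g (V (h y)) ∂μ := by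
        refine setLIntegral_mono' hT fun y hy => ?_
        gcongr
        have hle : V (h y) ≤ (1 - l) * V x₀ + l * V y := by
          simpa [hh] using hV.2 hx₀ hy (sub_nonneg.2 hl1) hl.le (by ring)
        exact hg (hpos _ (hmem y hy)) (lt_of_lt_of_le (hpos _ (hmem y hy)) hle) hle
    _ = ∫⁻ x in h '' T, g (V x) ∂μ := key.symm
    _ ≤ ∫⁻ x in T, g (V x) ∂μ := lintegral_mono_set (image_subset_iff.2 hmem)

theorem antitoneOn_ofReal_rpow_neg {a : ℝ} (ha : 0 ≤ a) :
    AntitoneOn (fun v : ℝ => ENNReal.ofReal (v ^ (-a))) (Ioi 0) := fun _ hx _ _ hxy =>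
  ENNReal.ofReal_le_ofReal (Real.rpow_le_rpow_of_nonpos hx hxy (by linarith))

/-- Bernoulli's inequality for an interpolated argument and a negative exponent. -/
theorem rpow_neg_interpolation_ge {a l v w : ℝ} (ha : 0 ≤ a) (hl : 0 < l) (hl1 : l ≤ 1)
    (hv : 0 < v) (hw : 0 < w) :
    l ^ (-a) * v ^ (-a) ≤ ((1 - l) * w + l * v) ^ (-a)
      + l ^ (-a) * (a * ((1 - l) / l) * w) * v ^ (-a - 1) := by
  -- The interpolated argument factors as `l v (1 + u)`, which reduces the claim to `(1 + u) ^ (-a)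
  -- ≥ 1 - a u`.
  set u := (1 - l) / l * w / v with hu
  have hu0 : 0 ≤ u := by
    have : 0 ≤ 1 - l := by linarith
    positivity
  have h1 : (1 - l) * w + l * v = l * v * (1 + u) := by
    rw [hu]; field_simp; ring
  have h2 : 1 - a * u ≤ (1 + u) ^ (-a) := by
    rw [Real.rpow_def_of_pos (by linarith)]
    have h3 := Real.log_le_sub_one_of_pos (show 0 < 1 + u by linarith)
    have h4 := Real.add_one_le_exp (Real.log (1 + u) * -a)
    nlinarith
  have h5 : v ^ (-a - 1) = v ^ (-a) / v := by
    rw [Real.rpow_sub_one hv.ne']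
  rw [h1, Real.mul_rpow (by positivity) (by linarith), Real.mul_rpow hl.le hv.le, h5]
  have h6 : l ^ (-a) * (a * ((1 - l) / l) * w) * (v ^ (-a) / v)
      = l ^ (-a) * v ^ (-a) * (a * u) := by
    rw [hu]; ring
  rw [h6]
  have h7 : 0 < l ^ (-a) * v ^ (-a) := by positivity
  nlinarith

/-- The moment inequality `(a - n) ∫ V ^ (-a) ≤ a V(x₀) ∫ V ^ (-a-1)` on an `n`-dimensional
convex set. -/
theorem sub_finrank_mul_lintegral_le {T : Set E} {V : E → ℝ} (hV : ConvexOn ℝ T V)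
    (hT : MeasurableSet T) (hVm : AEMeasurable V (μ.restrict T)) (hpos : ∀ x ∈ T, 0 < V x)
    {x₀ : E} (hx₀ : x₀ ∈ T) {a : ℝ} (ha : 0 ≤ a)
    (hna : (finrank ℝ E : ℝ) ≤ a)
    (hI : ∫⁻ x in T, ENNReal.ofReal (V x ^ (-a)) ∂μ ≠ ⊤)
    (hJ : ∫⁻ x in T, ENNReal.ofReal (V x ^ (-a - 1)) ∂μ ≠ ⊤) :
    (a - finrank ℝ E) * (∫⁻ x in T, ENNReal.ofReal (V x ^ (-a)) ∂μ).toReal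
      ≤ a * V x₀ * (∫⁻ x in T, ENNReal.ofReal (V x ^ (-a - 1)) ∂μ).toReal := by
  set n := finrank ℝ E
  set I := ∫⁻ x in T, ENNReal.ofReal (V x ^ (-a)) ∂μ
  set J := ∫⁻ x in T, ENNReal.ofReal (V x ^ (-a - 1)) ∂μ
  have hw := hpos x₀ hx₀
  -- For fixed `l` the homothety bound becomes `l ^ (n-a) I ≤ I + (1 - l) l ^ (n-a-1) a V(x₀) J`. As
  -- `l ^ (n-a) ≥ 1 + (a - n)(1 - l)`, the finite `I` cancels and `1 - l` divides out; then `l → 1`.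
  have step : ∀ l : ℝ, 0 < l → l < 1 →
      (a - n) * I.toReal ≤ l ^ ((n : ℝ) - a - 1) * (a * V x₀) * J.toReal := by
    intro l hl hl1
    have hom := lintegral_homothety_le (μ := μ) hV hT hpos hx₀ hl hl1.le
      (antitoneOn_ofReal_rpow_neg ha)
    set c := l ^ (-a) * (a * ((1 - l) / l) * V x₀) with hc
    have hc0 : 0 ≤ c := by
      have : 0 ≤ 1 - l := by linarith
      positivity
    set G := ∫⁻ y in T, ENNReal.ofReal (((1 - l) * V x₀ + l * V y) ^ (-a)) ∂μ
    have h1 : ENNReal.ofReal (l ^ (-a)) * I ≤ G + ENNReal.ofReal c * J := by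
      rw [← lintegral_const_mul' _ _ ENNReal.ofReal_ne_top,
        ← lintegral_const_mul' _ _ ENNReal.ofReal_ne_top, ← lintegral_add_right']
      · refine setLIntegral_mono' hT fun y hy => ?_
        have := hpos y hy
        have h0 : 0 < (1 - l) * V x₀ + l * V y := by
          have : 0 < 1 - l := by linarith
          positivity
        rw [← ENNReal.ofReal_mul (by positivity), ← ENNReal.ofReal_mul hc0,
          ← ENNReal.ofReal_add (by positivity) (by positivity)]
        exact ENNReal.ofReal_le_ofReal (rpow_neg_interpolation_ge ha hl hl1.le this hw)
      · exact ((hVm.pow_const _).ennreal_ofReal).const_mul _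
    have h2 : ENNReal.ofReal (l ^ n * l ^ (-a)) * I ≤ I + ENNReal.ofReal (l ^ n * c) * J := by
      rw [ENNReal.ofReal_mul (by positivity), ENNReal.ofReal_mul (by positivity), mul_assoc,
        mul_assoc]
      calc _ ≤ ENNReal.ofReal (l ^ n) * (G + ENNReal.ofReal c * J) := by gcongr
        _ = _ := mul_add _ _ _
        _ ≤ _ := by gcongr
    have h3 : l ^ n * l ^ (-a) * I.toReal ≤ I.toReal + l ^ n * c * J.toReal := by
      have := ENNReal.toReal_mono
        (ENNReal.add_ne_top.2 ⟨hI, ENNReal.mul_ne_top ENNReal.ofReal_ne_top hJ⟩) h2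
      rwa [ENNReal.toReal_add hI (ENNReal.mul_ne_top ENNReal.ofReal_ne_top hJ),
        ENNReal.toReal_mul, ENNReal.toReal_mul, ENNReal.toReal_ofReal (by positivity),
        ENNReal.toReal_ofReal (by positivity)] at this
    have h4 : l ^ n * l ^ (-a) = l ^ ((n : ℝ) - a) := by
      rw [← Real.rpow_natCast, ← Real.rpow_add hl]; ring_nf
    have h5 : l ^ n * c = l ^ ((n : ℝ) - a - 1) * (a * V x₀) * (1 - l) := by
      rw [hc, ← mul_assoc, h4, Real.rpow_sub_one hl.ne']; ring
    rw [h4, h5] at h3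
    have h6 : 1 + (a - n) * (1 - l) ≤ l ^ ((n : ℝ) - a) := by
      rw [Real.rpow_def_of_pos hl]
      have h7 := Real.log_le_sub_one_of_pos hl
      have h8 := Real.add_one_le_exp (Real.log l * (n - a))
      nlinarith
    have hI0 : 0 ≤ I.toReal := ENNReal.toReal_nonneg
    have h9 : 0 < 1 - l := by linarith
    have h10 := mul_le_mul_of_nonneg_right h6 hI0
    refine le_of_mul_le_mul_right ?_ h9
    nlinarith
  have hlim : Tendsto (fun l : ℝ => l ^ ((n : ℝ) - a - 1) * (a * V x₀) * J.toReal) (𝓝[<] 1)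
      (𝓝 (1 ^ ((n : ℝ) - a - 1) * (a * V x₀) * J.toReal)) := by
    refine ((Tendsto.mul_const _ (Tendsto.mul_const _ ?_))).mono_left nhdsWithin_le_nhds
    exact (Real.continuousAt_rpow_const 1 _ (Or.inl one_ne_zero))
  rw [Real.one_rpow, one_mul] at hlim
  refine ge_of_tendsto hlim ?_
  filter_upwards [Ioo_mem_nhdsLT (show (0 : ℝ) < 1 by norm_num)] with l hl
  exact step l hl.1 hl.2

/-- If `V ^ (-b)` has a finite positive integral, where `b` exceeds the dimension, then the convex
function `V` is bounded away from zero. -/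
theorem exists_pos_lower_bound {T : Set E} {V : E → ℝ} (hV : ConvexOn ℝ T V)
    (hT : MeasurableSet T) (hVm : AEMeasurable V (μ.restrict T)) (hpos : ∀ x ∈ T, 0 < V x)
    {b : ℝ} (hnb : (finrank ℝ E : ℝ) < b)
    (h0 : ∫⁻ x in T, ENNReal.ofReal (V x ^ (-b)) ∂μ ≠ 0)
    (hI : ∫⁻ x in T, ENNReal.ofReal (V x ^ (-b)) ∂μ ≠ ⊤) :
    ∃ m : ℝ, 0 < m ∧ ∀ x ∈ T, m ≤ V x := by
  by_contra! hcon
  set n := finrank ℝ E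
  set I := ∫⁻ x in T, ENNReal.ofReal (V x ^ (-b)) ∂μ
  have hb : 0 ≤ b := (Nat.cast_nonneg n).trans hnb.le
  -- Contracting by `1/2` towards points where `V` tends to `0` would in the limit replace `V` by `V
  -- / 2`, multiplying the integral by `2 ^ b`, whereas the Jacobian allows only `2 ^ n`.
  choose x hxT hx using fun k : ℕ => hcon (1 / ((k : ℝ) + 1)) (by positivity)
  have hVx : Tendsto (fun k => V (x k)) atTop (𝓝 0) :=
    squeeze_zero (fun k => (hpos _ (hxT k)).le) (fun k => (hx k).le)
      tendsto_one_div_add_atTop_nhds_zero_nat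
  set F : ℕ → E → ENNReal := fun k y =>
    ENNReal.ofReal (((1 - 1 / 2) * V (x k) + 1 / 2 * V y) ^ (-b)) with hF
  have hhom : ∀ k, ∫⁻ y in T, F k y ∂μ ≤ 2 ^ n * I := fun k => by
    have h := lintegral_homothety_le (μ := μ) hV hT hpos (hxT k) (l := 1 / 2) (by norm_num)
      (by norm_num) (antitoneOn_ofReal_rpow_neg hb)
    calc ∫⁻ y in T, F k y ∂μ
        = 2 ^ n * (ENNReal.ofReal ((1 / 2) ^ n) * ∫⁻ y in T, F k y ∂μ) := by
          rw [← mul_assoc, ENNReal.ofReal_pow (by norm_num), ← mul_pow, one_div,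
            ENNReal.ofReal_inv_of_pos (by norm_num), ENNReal.ofReal_ofNat,
            ENNReal.mul_inv_cancel (by norm_num) (by norm_num), one_pow, one_mul]
      _ ≤ _ := by gcongr
  have hlimit : ∀ y ∈ T, ENNReal.ofReal (2 ^ b) * ENNReal.ofReal (V y ^ (-b))
      ≤ liminf (fun k => F k y) atTop := fun y hy => by
    have hy0 := hpos y hy
    have : Tendsto (fun k => F k y) atTop
        (𝓝 (ENNReal.ofReal (((1 - 1 / 2) * 0 + 1 / 2 * V y) ^ (-b)))) := by
      refine ENNReal.tendsto_ofReal (Tendsto.rpow_const ?_ (Or.inl ?_))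
      · exact (hVx.const_mul _).add_const _
      · have : 0 < (1 - 1 / 2) * 0 + 1 / 2 * V y := by linarith
        exact this.ne'
    rw [this.liminf_eq, ← ENNReal.ofReal_mul (by positivity), mul_zero, zero_add,
      Real.mul_rpow (by norm_num) hy0.le, one_div, Real.inv_rpow (by norm_num),
      Real.rpow_neg (show (0 : ℝ) ≤ 2 by norm_num), inv_inv]
  have hfatou : ENNReal.ofReal (2 ^ b) * I ≤ 2 ^ n * I := by
    rw [← lintegral_const_mul' _ _ ENNReal.ofReal_ne_top]
    calc _ ≤ ∫⁻ y in T, liminf (fun k => F k y) atTop ∂μ := setLIntegral_mono' hT hlimit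
      _ ≤ liminf (fun k => ∫⁻ y in T, F k y ∂μ) atTop :=
        lintegral_liminf_le' fun k =>
          (((hVm.const_mul _).const_add _).pow_const _).ennreal_ofReal
      _ ≤ liminf (fun _ : ℕ => 2 ^ n * I) atTop := liminf_le_liminf (Eventually.of_forall hhom)
      _ = _ := by simp
  have h1 : ENNReal.ofReal (2 ^ b) ≤ 2 ^ n :=
    (ENNReal.mul_le_mul_iff_left h0 hI).1 hfatou
  have h2 : (2 : ENNReal) ^ n = ENNReal.ofReal (2 ^ (n : ℝ)) := by
    rw [Real.rpow_natCast, ENNReal.ofReal_pow (by norm_num), ENNReal.ofReal_ofNat]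
  rw [h2, ENNReal.ofReal_le_ofReal_iff (by positivity)] at h1
  exact absurd h1 (not_le.2 (Real.rpow_lt_rpow_of_exponent_lt (by norm_num) hnb))

/-- Half-moment bound: for a density `V ^ (-b)`, the mean of `V ^ (1/2)` is at most a dimensional
multiple of its infimum. -/
theorem lintegral_rpow_half_le {T : Set E} {V : E → ℝ} (hV : ConvexOn ℝ T V)
    (hT : IsOpen T) {b m : ℝ} (hm : 0 < m) (hmT : IsGLB (V '' T) m)
    (hnb : (finrank ℝ E : ℝ) + 1 ≤ b) (hTn : T.Nonempty)
    (hI : ∫⁻ x in T, ENNReal.ofReal (V x ^ (-b)) ∂μ = 1) :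
    ∫⁻ x in T, ENNReal.ofReal (V x ^ (-(b - 1 / 2))) ∂μ
      ≤ ENNReal.ofReal ((b - 1 / 2) / (b - 1 / 2 - finrank ℝ E) * m ^ (1 / 2 : ℝ)) := by
  set n := finrank ℝ E
  -- The shift `1/2` keeps `a > n`, as `b ≥ n + 1`, and makes `V ^ (-a-1) = V ^ (-1/2) V ^ (-b)`,
  -- whose integral is at most `m ^ (-1/2)`.
  set a := b - 1 / 2 with ha
  have hn0 : (0 : ℝ) ≤ n := Nat.cast_nonneg n
  have han : 0 < a - n := by linarith
  have ha0 : 0 < a := by linarith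
  have hle : ∀ x ∈ T, m ≤ V x := fun x hx => hmT.1 (mem_image_of_mem _ hx)
  have hpos : ∀ x ∈ T, 0 < V x := fun x hx => hm.trans_le (hle x hx)
  have hVc : ContinuousOn V T := hV.continuousOn hT
  have hVm : AEMeasurable V (μ.restrict T) := hVc.aemeasurable hT.measurableSet
  -- The moment inequality presupposes that `∫ V ^ (-a)` is finite. On the convex set `V ≤ R` this
  -- follows from `V ^ (1/2) ≤ R ^ (1/2)`, and the resulting bound does not involve `R`.
  set U : ℝ → Set E := fun R => {x ∈ T | V x ≤ R} with hU
  have hUT : ∀ R, U R ⊆ T := fun R x hx => hx.1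
  have hUm : ∀ R, MeasurableSet (U R) := fun R => by
    have : U R = T \ (T ∩ V ⁻¹' Ioi R) := by
      ext x; simp only [hU, mem_ofPred_eq, Set.mem_sdiff, mem_inter_iff, mem_preimage, mem_Ioi]
      constructor
      · rintro ⟨h1, h2⟩; exact ⟨h1, fun h => absurd h.2 (not_lt.2 h2)⟩
      · rintro ⟨h1, h2⟩; exact ⟨h1, not_lt.1 fun h => h2 ⟨h1, h⟩⟩
    rw [this]
    exact hT.measurableSet.diff (hVc.isOpen_inter_preimage hT isOpen_Ioi).measurableSet
  -- A bound on the sublevel sets, uniform in the level.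
  have htrunc : ∀ x₀ ∈ T, ∀ R, V x₀ ≤ R →
      ∫⁻ x in U R, ENNReal.ofReal (V x ^ (-a)) ∂μ
        ≤ ENNReal.ofReal (a / (a - n) * V x₀ * m ^ (-(1 / 2) : ℝ)) := by
    intro x₀ hx₀ R hR
    have hVR : ConvexOn ℝ (U R) V := hV.subset (hUT R) (hV.convex_le R)
    have hw := hpos x₀ hx₀
    have hR0 : 0 < R := hw.trans_le hR
    have hIU : ∫⁻ x in U R, ENNReal.ofReal (V x ^ (-b)) ∂μ ≤ 1 :=
      (lintegral_mono_set (hUT R)).trans_eq hI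
    have hIle : ∫⁻ x in U R, ENNReal.ofReal (V x ^ (-a)) ∂μ ≤ ENNReal.ofReal (R ^ (1 / 2 : ℝ)) := by
      calc _ ≤ ∫⁻ x in U R, ENNReal.ofReal (R ^ (1 / 2 : ℝ)) * ENNReal.ofReal (V x ^ (-b)) ∂μ := by
            refine setLIntegral_mono' (hUm R) fun x hx => ?_
            have hx0 := hpos x hx.1
            rw [← ENNReal.ofReal_mul (by positivity)]
            refine ENNReal.ofReal_le_ofReal ?_
            have : V x ^ (-a) = V x ^ (1 / 2 : ℝ) * V x ^ (-b) := by
              rw [← Real.rpow_add hx0, ha]; ring_nf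
            rw [this]
            gcongr
            exact hx.2
        _ = _ := lintegral_const_mul' _ _ ENNReal.ofReal_ne_top
        _ ≤ ENNReal.ofReal (R ^ (1 / 2 : ℝ)) * 1 := by gcongr
        _ = _ := mul_one _
    have hJle : ∫⁻ x in U R, ENNReal.ofReal (V x ^ (-a - 1)) ∂μ
        ≤ ENNReal.ofReal (m ^ (-(1 / 2) : ℝ)) := by
      calc _ ≤ ∫⁻ x in U R,
              ENNReal.ofReal (m ^ (-(1 / 2) : ℝ)) * ENNReal.ofReal (V x ^ (-b)) ∂μ := by
            refine setLIntegral_mono' (hUm R) fun x hx => ?_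
            have hx0 := hpos x hx.1
            rw [← ENNReal.ofReal_mul (by positivity)]
            refine ENNReal.ofReal_le_ofReal ?_
            have : V x ^ (-a - 1) = V x ^ (-(1 / 2) : ℝ) * V x ^ (-b) := by
              rw [← Real.rpow_add hx0, ha]; ring_nf
            rw [this]
            exact mul_le_mul_of_nonneg_right
              (Real.rpow_le_rpow_of_nonpos hm (hle x hx.1) (by norm_num)) (by positivity)
        _ = _ := lintegral_const_mul' _ _ ENNReal.ofReal_ne_top
        _ ≤ ENNReal.ofReal (m ^ (-(1 / 2) : ℝ)) * 1 := by gcongr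
        _ = _ := mul_one _
    have hIt := ne_top_of_le_ne_top ENNReal.ofReal_ne_top hIle
    have hJt := ne_top_of_le_ne_top ENNReal.ofReal_ne_top hJle
    have hmain := sub_finrank_mul_lintegral_le hVR (hUm R)
      (hVm.mono_measure (Measure.restrict_mono (hUT R) le_rfl)) (fun x hx => hpos x hx.1)
      (show x₀ ∈ U R from ⟨hx₀, hR⟩) ha0.le (by linarith) hIt hJt
    have hJr := ENNReal.toReal_le_of_le_ofReal (by positivity) hJle
    rw [← ENNReal.ofReal_toReal hIt]
    refine ENNReal.ofReal_le_ofReal ?_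
    have h1 := hmain.trans (mul_le_mul_of_nonneg_left hJr (by positivity))
    have h2 : a / (a - n) * V x₀ * m ^ (-(1 / 2) : ℝ)
        = a * V x₀ * m ^ (-(1 / 2) : ℝ) / (a - n) := by ring
    rw [h2, le_div_iff₀ han]
    linarith
  have hpt : ∀ x₀ ∈ T, ∫⁻ x in T, ENNReal.ofReal (V x ^ (-a)) ∂μ
      ≤ ENNReal.ofReal (a / (a - n) * V x₀ * m ^ (-(1 / 2) : ℝ)) := by
    intro x₀ hx₀
    have hUn : T = ⋃ k : ℕ, U (V x₀ + k) := by
      ext x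
      simp only [hU, mem_iUnion, mem_ofPred_eq]
      refine ⟨fun hx => ?_, fun ⟨_, h⟩ => h.1⟩
      obtain ⟨k, hk⟩ := exists_nat_ge (V x - V x₀)
      exact ⟨k, hx, by linarith⟩
    have hdir : Directed (· ⊆ ·) fun k : ℕ => U (V x₀ + k) :=
      Monotone.directed_le fun i j hij x hx =>
        ⟨hx.1, hx.2.trans (by have : (i : ℝ) ≤ j := by exact_mod_cast hij
                              linarith)⟩
    rw [hUn, setLIntegral_iUnion_of_directed _ hdir]
    exact iSup_le fun k => htrunc x₀ hx₀ _ (by simp)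
  have hfin := ne_top_of_le_ne_top ENNReal.ofReal_ne_top (hpt _ hTn.some_mem)
  have hmm : m * m ^ (-(1 / 2) : ℝ) = m ^ (1 / 2 : ℝ) := by
    rw [← Real.rpow_one_add' hm.le (by norm_num)]; norm_num
  rw [← hmm, ← mul_assoc, mul_right_comm]
  rw [← ENNReal.ofReal_toReal hfin]
  refine ENNReal.ofReal_le_ofReal ?_
  -- The bound is `A * V x₀` for every `x₀` in `T`, so the infimum over `x₀` may be taken even if it
  -- is not attained.
  set A := a / (a - n) * m ^ (-(1 / 2) : ℝ) with hA
  have hA0 : 0 < A := by positivity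
  rw [← div_le_iff₀' hA0]
  refine hmT.2 ?_
  rintro _ ⟨x, hx, rfl⟩
  have hx0 := hpos x hx
  rw [div_le_iff₀' hA0]
  have := ENNReal.toReal_le_of_le_ofReal (by positivity) (hpt x hx)
  calc _ ≤ _ := this
    _ = _ := by rw [hA]; ring

end Homothety

/-! ### Chebyshev's inequality for the information content. -/

/-- A nonnegative function bounded by `M` with integral one whose entropy exceeds `-log M` by at
most `A` carries at least the mass `1 - A / B` on the set where it is at least `M exp (-B)`. -/
theorem superlevel_bounds_of_entropy_le {α : Type*} [MeasurableSpace α] {ν : Measure α}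
    {p : α → ℝ} (hp0 : ∀ᵐ x ∂ν, 0 < p x) (hp : Integrable p ν) (hp1 : ∫ x, p x ∂ν = 1)
    {M A B : ℝ} (hM : 0 < M) (hpM : ∀ᵐ x ∂ν, p x ≤ M) (hB : 0 < B)
    (hlog : Integrable (fun x => -(p x * Real.log (p x))) ν)
    (hA : Real.log M + ∫ x, -(p x * Real.log (p x)) ∂ν ≤ A) :
    -Real.log M ≤ ∫ x, -(p x * Real.log (p x)) ∂ν ∧
    ν {x | M * Real.exp (-B) ≤ p x} < ⊤ ∧
    M * Real.exp (-B) * ν.real {x | M * Real.exp (-B) ≤ p x} ≤ 1 ∧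
    1 - A / B ≤ M * ν.real {x | M * Real.exp (-B) ≤ p x} := by
  set K := {x | M * Real.exp (-B) ≤ p x} with hK
  have hε : 0 < M * Real.exp (-B) := by positivity
  have hp0' : 0 ≤ᵐ[ν] p := hp0.mono fun x hx => hx.le
  have hKfin : ν K < ⊤ := hp.measure_ge_lt_top hε
  have hgap : ∫ x, p x * Real.log M + -(p x * Real.log (p x)) ∂ν
      = Real.log M + ∫ x, -(p x * Real.log (p x)) ∂ν := by
    rw [integral_add (hp.mul_const _) hlog, integral_mul_const, hp1, one_mul]
  refine ⟨?_, hKfin, ?_, ?_⟩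
  · have h : 0 ≤ ∫ x, p x * Real.log M + -(p x * Real.log (p x)) ∂ν := by
      refine integral_nonneg_of_ae ?_
      filter_upwards [hp0, hpM] with x h0 h1
      have := Real.log_le_log h0 h1
      show 0 ≤ p x * Real.log M + -(p x * Real.log (p x))
      nlinarith
    linarith
  · exact (mul_meas_ge_le_integral_of_nonneg hp0' hp _).trans_eq hp1
  · have hKm : NullMeasurableSet K ν := nullMeasurableSet_le aemeasurable_const hp.1.aemeasurable
    have hind : Integrable (K.indicator fun _ => M) ν :=
      IntegrableOn.integrable_indicator₀ (integrableOn_const hKfin.ne) hKm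
    have hgi : Integrable (fun x => (p x * Real.log M + -(p x * Real.log (p x))) / B) ν :=
      ((hp.mul_const _).add hlog).div_const B
    -- Pointwise, `p ≤ M` on `K`, while off `K` one has `log (M / p) > B`, so `p ≤ p log (M / p) /
    -- B`.
    have h : ∫ x, p x ∂ν ≤ ∫ x, K.indicator (fun _ => M) x
        + (p x * Real.log M + -(p x * Real.log (p x))) / B ∂ν := by
      refine integral_mono_ae hp (hind.add hgi) ?_
      filter_upwards [hp0, hpM] with x h0 h1
      have hl := Real.log_le_log h0 h1
      by_cases hx : x ∈ K
      · rw [indicator_of_mem hx]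
        have : 0 ≤ (p x * Real.log M + -(p x * Real.log (p x))) / B :=
          div_nonneg (by nlinarith) hB.le
        linarith
      · rw [indicator_of_notMem hx, zero_add, le_div_iff₀ hB]
        have h2 : p x < M * Real.exp (-B) := not_le.1 hx
        have h3 := Real.log_lt_log h0 h2
        rw [Real.log_mul hM.ne' (Real.exp_pos _).ne', Real.log_exp] at h3
        nlinarith
    rw [hp1, integral_add hind hgi, integral_indicator₀ hKm, setIntegral_const, integral_div,
      hgap, smul_eq_mul] at h
    have h4 : (Real.log M + ∫ x, -(p x * Real.log (p x)) ∂ν) / B ≤ A / B := by gcongr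
    linarith

/-! ### The entropy gap of a convex density. -/

/-- For a density `V ^ (-b)` on an open convex set of dimension `n`, the entropy is finite and
exceeds `-log ‖V ^ (-b)‖` by at most `4 b n / (b - n)`. -/
theorem entropy_rpow_neg_le {E : Type*} [NormedAddCommGroup E] [NormedSpace ℝ E]
    [FiniteDimensional ℝ E] [MeasurableSpace E] [BorelSpace E] {μ : Measure E}
    [μ.IsAddHaarMeasure] {T : Set E} {V : E → ℝ} (hV : ConvexOn ℝ T V) (hT : IsOpen T)
    (hpos : ∀ x ∈ T, 0 < V x) {b : ℝ} (hnb : (finrank ℝ E : ℝ) + 1 ≤ b)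
    (hI : ∫⁻ x in T, ENNReal.ofReal (V x ^ (-b)) ∂μ = 1) :
    ∃ L : ℝ, 0 < L ∧ (∀ x ∈ T, V x ^ (-b) ≤ L) ∧
      IntegrableOn (fun x => -(V x ^ (-b) * Real.log (V x ^ (-b)))) T μ ∧
      Real.log L + ∫ x in T, -(V x ^ (-b) * Real.log (V x ^ (-b))) ∂μ
        ≤ 4 * b * finrank ℝ E / (b - finrank ℝ E) := by
  set n := finrank ℝ E
  have hn0 : (0 : ℝ) ≤ n := Nat.cast_nonneg n
  have hTn : T.Nonempty := by
    by_contra h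
    rw [not_nonempty_iff_eq_empty.1 h] at hI
    simp at hI
  have hVm : AEMeasurable V (μ.restrict T) :=
    (hV.continuousOn hT).aemeasurable hT.measurableSet
  obtain ⟨m₀, hm₀, hm₀V⟩ := exists_pos_lower_bound (b := b) hV hT.measurableSet hVm hpos
    (by linarith) (by simp [hI]) (by simp [hI])
  have hglb : IsGLB (V '' T) (sInf (V '' T)) :=
    isGLB_csInf (hTn.image V) ⟨m₀, by rintro _ ⟨x, hx, rfl⟩; exact hm₀V x hx⟩
  set m := sInf (V '' T)
  have hm : 0 < m :=
    hm₀.trans_le (hglb.2 (by rintro _ ⟨x, hx, rfl⟩; exact hm₀V x hx))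
  have hmV : ∀ x ∈ T, m ≤ V x := fun x hx => hglb.1 (mem_image_of_mem _ hx)
  have hhalf := lintegral_rpow_half_le hV hT hm hglb hnb hTn hI
  set a := b - 1 / 2 with ha
  have hb0 : 0 < b := by linarith
  have han : 0 < a - n := by linarith
  have hae : ∀ r : ℝ, 0 ≤ᵐ[μ.restrict T] fun x => V x ^ r := fun r =>
    (ae_restrict_iff' hT.measurableSet).2 (ae_of_all _ fun x hx => (Real.rpow_pos_of_pos (hpos x hx) r).le)
  have hi : ∀ r : ℝ, ∫⁻ x in T, ENNReal.ofReal (V x ^ r) ∂μ ≠ ⊤ →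
      IntegrableOn (fun x => V x ^ r) T μ := fun r hr =>
    (lintegral_ofReal_ne_top_iff_integrable (hVm.pow_const r).aestronglyMeasurable (hae r)).1 hr
  have hib := hi (-b) (by simp [hI])
  have hia := hi (-a) (ne_top_of_le_ne_top ENNReal.ofReal_ne_top hhalf)
  have hib1 : ∫ x in T, V x ^ (-b) ∂μ = 1 := by
    rw [integral_eq_lintegral_of_nonneg_ae (hae _) hib.1, hI, ENNReal.toReal_one]
  have hia1 : ∫ x in T, V x ^ (-a) ∂μ ≤ a / (a - n) * m ^ (1 / 2 : ℝ) := by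
    rw [integral_eq_lintegral_of_nonneg_ae (hae _) hia.1]
    have : 0 ≤ a := by linarith
    exact ENNReal.toReal_le_of_le_ofReal (by positivity) hhalf
  -- The entropy integrand, compared with the half moment.
  have hlow : ∀ x ∈ T, V x ^ (-b) * (b * Real.log m) ≤ -(V x ^ (-b) * Real.log (V x ^ (-b))) := by
    intro x hx
    have h1 := Real.log_le_log hm (hmV x hx)
    have h2 : 0 < V x ^ (-b) := Real.rpow_pos_of_pos (hpos x hx) _
    rw [Real.log_rpow (hpos x hx)]
    have := mul_le_mul_of_nonneg_left (mul_le_mul_of_nonneg_left h1 hb0.le) h2.le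
    linarith
  -- This is `log t ≤ t - 1` at `t = (V / m) ^ (1/2)`, multiplied by `2 b V ^ (-b)`.
  have hup : ∀ x ∈ T, -(V x ^ (-b) * Real.log (V x ^ (-b)))
      ≤ V x ^ (-b) * (b * Real.log m)
        + 2 * b * (m ^ (-(1 / 2) : ℝ) * V x ^ (-a) - V x ^ (-b)) := by
    intro x hx
    have hx0 := hpos x hx
    have h2 : 0 < V x ^ (-b) := Real.rpow_pos_of_pos hx0 _
    have h3 := Real.log_le_sub_one_of_pos
      (show 0 < m ^ (-(1 / 2) : ℝ) * V x ^ (1 / 2 : ℝ) by positivity)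
    rw [Real.log_mul (by positivity) (by positivity), Real.log_rpow hm, Real.log_rpow hx0] at h3
    have h4 : V x ^ (-a) = V x ^ (1 / 2 : ℝ) * V x ^ (-b) := by
      rw [← Real.rpow_add hx0, ha]; ring_nf
    rw [Real.log_rpow hx0, h4]
    have := mul_le_mul_of_nonneg_left h3 (show 0 ≤ 2 * b * V x ^ (-b) by positivity)
    linarith
  have hilow : IntegrableOn (fun x => V x ^ (-b) * (b * Real.log m)) T μ := hib.mul_const _
  have hidiff : IntegrableOn
      (fun x => 2 * b * (m ^ (-(1 / 2) : ℝ) * V x ^ (-a) - V x ^ (-b))) T μ :=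
    ((hia.const_mul _).sub hib).const_mul _
  have hiup : IntegrableOn (fun x => V x ^ (-b) * (b * Real.log m)
      + 2 * b * (m ^ (-(1 / 2) : ℝ) * V x ^ (-a) - V x ^ (-b))) T μ := hilow.add hidiff
  have hms : AEStronglyMeasurable (fun x => -(V x ^ (-b) * Real.log (V x ^ (-b))))
      (μ.restrict T) :=
    ((hVm.pow_const _).mul (hVm.pow_const _).log).neg.aestronglyMeasurable
  have hlowae := (ae_restrict_iff' (μ := μ) hT.measurableSet).2 (ae_of_all _ hlow)
  have hupae := (ae_restrict_iff' (μ := μ) hT.measurableSet).2 (ae_of_all _ hup)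
  have hint : IntegrableOn (fun x => -(V x ^ (-b) * Real.log (V x ^ (-b)))) T μ :=
    integrable_of_le_of_le hms hlowae hupae hilow hiup
  refine ⟨m ^ (-b), by positivity, fun x hx =>
    Real.rpow_le_rpow_of_nonpos hm (hmV x hx) (by linarith), hint, ?_⟩
  have h1 : ∫ x in T, -(V x ^ (-b) * Real.log (V x ^ (-b))) ∂μ
      ≤ b * Real.log m + 2 * b * (m ^ (-(1 / 2) : ℝ) * ∫ x in T, V x ^ (-a) ∂μ) - 2 * b := by
    refine (integral_mono_ae hint hiup hupae).trans_eq ?_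
    rw [integral_add hilow hidiff, integral_mul_const, integral_const_mul,
      integral_sub (hia.const_mul _) hib, integral_const_mul, hib1]
    ring
  have h2 : m ^ (-(1 / 2) : ℝ) * ∫ x in T, V x ^ (-a) ∂μ ≤ a / (a - n) := by
    calc _ ≤ m ^ (-(1 / 2) : ℝ) * (a / (a - n) * m ^ (1 / 2 : ℝ)) := by gcongr
      _ = a / (a - n) * (m ^ (-(1 / 2) : ℝ) * m ^ (1 / 2 : ℝ)) := by ring
      _ = _ := by rw [← Real.rpow_add hm]; norm_num
  -- The left side is `n / (a - n)`, and `b - n ≥ 1` gives `a - n = b - n - 1/2 ≥ (b - n) / 2`.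
  have h3 : a / (a - n) - 1 ≤ 2 * n / (b - n) := by
    rw [div_sub_one han.ne', div_le_div_iff₀ han (by linarith)]
    nlinarith
  have h4 := mul_le_mul_of_nonneg_left (h2.trans (sub_le_iff_le_add.1 h3))
    (show 0 ≤ 2 * b by positivity)
  have h5 : 2 * b * (2 * n / (b - n) + 1) = 4 * b * n / (b - n) + 2 * b := by ring
  rw [Real.log_rpow hm]
  linarith

/-! ### From the random vector to its density on an open convex set. -/

/-- The frontier of a convex set is null. Passing to the interior makes a convex `V` continuous,
which supplies the measurability that is not assumed of `S` and `V`. -/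
theorem convexDensity_ae_eq_interior {n : ℕ} {S : Set (EuclideanSpace ℝ (Fin n))}
    (hS : Convex ℝ S) (V : EuclideanSpace ℝ (Fin n) → ℝ) (b : ℝ) :
    convexDensity S V b =ᵐ[volume] (interior S).indicator fun x => V x ^ (-b) :=
  (indicator_ae_eq_of_ae_eq_set
    (interior_ae_eq_of_null_frontier (hS.addHaar_frontier volume))).symm

theorem HasDensity.pdf_ae_eq {Ω : Type*} [MeasurableSpace Ω] {n : ℕ} {P : Measure Ω}
    {X : Ω → EuclideanSpace ℝ (Fin n)} {f : EuclideanSpace ℝ (Fin n) → ℝ}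
    (h : HasDensity P X f) (hf : AEMeasurable f volume) :
    pdf X P volume =ᵐ[volume] fun x => ENNReal.ofReal (f x) := by
  rw [pdf_def, h.2]
  exact Measure.rnDeriv_withDensity₀ volume hf.ennreal_ofReal

theorem HasDensity.lintegral_eq_one {Ω : Type*} [MeasurableSpace Ω] {n : ℕ} {P : Measure Ω}
    [IsProbabilityMeasure P] {X : Ω → EuclideanSpace ℝ (Fin n)}
    {f : EuclideanSpace ℝ (Fin n) → ℝ} (h : HasDensity P X f) :
    ∫⁻ x, ENNReal.ofReal (f x) = 1 := by
  rw [← setLIntegral_univ, ← withDensity_apply _ MeasurableSet.univ, ← h.2]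
  have := Measure.isProbabilityMeasure_map (μ := P) h.1
  exact measure_univ

/-- The entropy and the essential support of a density `V ^ (-b)`, in terms of its maximum `M`. -/
theorem exists_entropy_bounds {β₀ : ℝ} (hβ₀ : 1 < β₀) {n : ℕ} (hn : 1 ≤ n) {b : ℝ}
    (hnb : (n : ℝ) + 1 ≤ b) (hb : β₀ * n ≤ b) {S : Set (EuclideanSpace ℝ (Fin n))}
    {V : EuclideanSpace ℝ (Fin n) → ℝ} (hV : ConvexOn ℝ S V) (hpos : ∀ x ∈ S, 0 < V x)
    {Ω : Type*} [MeasurableSpace Ω] {P : Measure Ω} [IsProbabilityMeasure P]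
    {X : Ω → EuclideanSpace ℝ (Fin n)} (hX : HasDensity P X (convexDensity S V b)) :
    ∃ M : ℝ, 0 < M ∧ HasFiniteEntropy P X ∧
      volume (essentialSupport β₀ (convexDensity S V b)) < ⊤ ∧
      -Real.log M ≤ entropy P X ∧
      entropy P X ≤ -Real.log M + 4 * (β₀ / (β₀ - 1)) * n ∧
      M * essConst β₀ ^ n * (volume (essentialSupport β₀ (convexDensity S V b))).toReal ≤ 1 ∧
      1 / 2 ≤ M * (volume (essentialSupport β₀ (convexDensity S V b))).toReal := by
  have hn0 : (0 : ℝ) < n := by exact_mod_cast hn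
  have hβ1 : 0 < β₀ - 1 := by linarith
  set f := convexDensity S V b
  set T := interior S
  set p : EuclideanSpace ℝ (Fin n) → ℝ := fun x => V x ^ (-b)
  have hT : IsOpen T := isOpen_interior
  have hTm : MeasurableSet T := hT.measurableSet
  have hVT : ConvexOn ℝ T V := hV.subset interior_subset hV.1.interior
  have hposT : ∀ x ∈ T, 0 < V x := fun x hx => hpos x (interior_subset hx)
  have hfT : f =ᵐ[volume] T.indicator p := convexDensity_ae_eq_interior hV.1 V b
  have hVm : AEMeasurable V (volume.restrict T) := (hVT.continuousOn hT).aemeasurable hTm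
  have hpm : AEMeasurable p (volume.restrict T) := hVm.pow_const _
  have hfm : AEMeasurable f volume := ((aemeasurable_indicator_iff hTm).2 hpm).congr hfT.symm
  have hpT : ∀ x ∈ T, 0 < p x := fun x hx => Real.rpow_pos_of_pos (hposT x hx) _
  have hpae : ∀ᵐ x ∂volume.restrict T, 0 < p x := (ae_restrict_iff' hTm).2 (ae_of_all _ hpT)
  have hI : ∫⁻ x in T, ENNReal.ofReal (p x) = 1 := by
    rw [← hX.lintegral_eq_one, ← lintegral_indicator hTm]
    refine lintegral_congr_ae ?_
    filter_upwards [hfT] with x hx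
    rw [hx]
    by_cases h : x ∈ T <;> simp [h]
  obtain ⟨L, hL, hpL, hlog, hLent⟩ :=
    entropy_rpow_neg_le hVT hT hposT (by simpa using hnb) hI
  rw [finrank_euclideanSpace_fin] at hLent
  -- The essential supremum.
  set D := densityMax f
  have hDL : D ≤ ENNReal.ofReal L := by
    refine essSup_le_of_ae_le _ ?_
    filter_upwards [hfT] with x hx
    rw [hx]
    refine ENNReal.ofReal_le_ofReal ?_
    by_cases h : x ∈ T
    · simpa [h] using hpL x h
    · simpa [h] using hL.le
  have hDtop : D ≠ ⊤ := ne_top_of_le_ne_top ENNReal.ofReal_ne_top hDL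
  have hfD : ∀ᵐ x, ENNReal.ofReal (f x) ≤ D := ENNReal.ae_le_essSup _
  have hD0 : D ≠ 0 := fun h => by
    have h1 : ∫⁻ x, ENNReal.ofReal (f x) = 0 := by
      rw [lintegral_congr_ae (g := 0), Pi.zero_def, lintegral_zero]
      filter_upwards [hfD] with x hx
      simpa [h] using hx
    rw [hX.lintegral_eq_one] at h1
    exact one_ne_zero h1
  have hM : 0 < D.toReal := ENNReal.toReal_pos hD0 hDtop
  set M := D.toReal
  have hDM : D = ENNReal.ofReal M := (ENNReal.ofReal_toReal hDtop).symm
  -- This inequality suffices to transfer the entropy bound from the pointwise bound `L` to the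
  -- essential supremum `M`.
  have hML : M ≤ L := ENNReal.toReal_le_of_le_ofReal hL.le hDL
  have hpM : ∀ᵐ x ∂volume.restrict T, p x ≤ M := by
    rw [ae_restrict_iff' hTm]
    filter_upwards [hfT, hfD] with x hx hxD hxT
    rw [hx, indicator_of_mem hxT, hDM] at hxD
    exact (ENNReal.ofReal_le_ofReal_iff hM.le).1 hxD
  -- The entropy.
  have hpint : Integrable p (volume.restrict T) :=
    (lintegral_ofReal_ne_top_iff_integrable hpm.aestronglyMeasurable
      (hpae.mono fun x hx => hx.le)).1 (by simp [hI])
  have hp1 : ∫ x in T, p x = 1 := by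
    rw [integral_eq_lintegral_of_nonneg_ae (hpae.mono fun x hx => hx.le) hpint.1, hI,
      ENNReal.toReal_one]
  have hent : entropyIntegrand P X =ᵐ[volume]
      T.indicator fun x => -(p x * Real.log (p x)) := by
    filter_upwards [hX.pdf_ae_eq hfm, hfT] with x h1 h2
    rw [entropyIntegrand, h1, h2]
    by_cases h : x ∈ T
    · simp [h, ENNReal.toReal_ofReal (hpT x h).le]
    · simp [h]
  have hfin : HasFiniteEntropy P X :=
    ((integrable_indicator_iff hTm).2 hlog).congr hent.symm
  have hentropy : entropy P X = ∫ x in T, -(p x * Real.log (p x)) := by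
    rw [entropy, integral_congr_ae hent, integral_indicator hTm]
  set κ := β₀ / (β₀ - 1) with hκ
  have hκ0 : 0 < κ := by positivity
  have hAκ : 4 * b * n / (b - n) ≤ 4 * κ * n := by
    -- The ratio `b / (b - n)` decreases in `b` and equals `κ` at `b = β₀ n`.
    have h1 : b / (b - n) ≤ κ := by
      rw [hκ, div_le_div_iff₀ (by linarith) hβ1]
      nlinarith
    have h2 : 4 * b * n / (b - n) = 4 * (b / (b - n)) * n := by ring
    rw [h2]; gcongr
  have hA : Real.log M + ∫ x in T, -(p x * Real.log (p x)) ≤ 4 * κ * n := by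
    have := Real.log_le_log hM hML
    linarith
  -- The level `B = 32 κ n` makes `exp (-B) = c₀ⁿ`; against the entropy gap `A = 4 κ n` it leaves
  -- mass at most `A / B = 1/8` outside `K_f`.
  have hB : 0 < 32 * κ * n := by positivity
  obtain ⟨h1, h2, h3, h4⟩ := superlevel_bounds_of_entropy_le hpae hpint hp1 hM hpM hB hlog hA
  have hconst : Real.exp (-(32 * κ * n)) = essConst β₀ ^ n := by
    rw [essConst, ← Real.exp_nat_mul, hκ]
    congr 1; ring
  rw [hconst] at h2 h3 h4
  have hc : 0 < essConst β₀ ^ n := pow_pos (Real.exp_pos _) n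
  -- The threshold `M c₀ⁿ` is positive, so points outside `T`, where `f` vanishes almost everywhere,
  -- contribute nothing.
  have hK : volume (essentialSupport β₀ f)
      = volume.restrict T {x | M * essConst β₀ ^ n ≤ p x} := by
    rw [Measure.restrict_apply' hTm]
    refine measure_congr ?_
    filter_upwards [hfT] with x hx
    refine propext ?_
    show ENNReal.ofReal (essConst β₀ ^ n) * D ≤ ENNReal.ofReal (f x)
      ↔ M * essConst β₀ ^ n ≤ p x ∧ x ∈ T
    rw [hx, hDM, ← ENNReal.ofReal_mul hc.le, mul_comm]
    have hMc : 0 < M * essConst β₀ ^ n := by positivity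
    by_cases h : x ∈ T
    · simp only [h, indicator_of_mem, and_true]
      exact ENNReal.ofReal_le_ofReal_iff (hpT x h).le
    · simp [h, hMc]
  refine ⟨M, hM, hfin, hK ▸ h2, hentropy ▸ h1, by rw [hentropy]; linarith, ?_, ?_⟩
  · rw [hK]; exact h3
  · rw [hK]
    refine le_trans ?_ h4
    have : 4 * κ * n / (32 * κ * n) = 1 / 8 := by field_simp; norm_num
    rw [this]; norm_num

/-! ### Comparison of entropy power and volume. -/

theorem corollary5 (β₀ : ℝ) (hβ₀ : 1 < β₀) :
    ∃ C' C'' : ℝ, 0 < C' ∧ C' < C'' ∧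
      ∀ (n : ℕ), 1 ≤ n →
      ∀ (β : ℝ), (n : ℝ) + 1 ≤ β → β₀ * n ≤ β →
      ∀ (S : Set (EuclideanSpace ℝ (Fin n))) (V : EuclideanSpace ℝ (Fin n) → ℝ),
        ConvexOn ℝ S V → (∀ x ∈ S, 0 < V x) →
      ∀ (Ω : Type*) [MeasurableSpace Ω] (P : Measure Ω) [IsProbabilityMeasure P]
        (X : Ω → EuclideanSpace ℝ (Fin n)),
        HasDensity P X (convexDensity S V β) →
        HasFiniteEntropy P X ∧
        volume (essentialSupport β₀ (convexDensity S V β)) < ⊤ ∧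
        C' * (volume (essentialSupport β₀ (convexDensity S V β))).toReal ^ (2 / (n : ℝ))
          ≤ entropyPower P X ∧
        entropyPower P X ≤
          C'' * (volume (essentialSupport β₀ (convexDensity S V β))).toReal ^ (2 / (n : ℝ)) := by
  have hβ1 : 0 < β₀ - 1 := by linarith
  set κ := β₀ / (β₀ - 1) with hκ
  have hκ0 : 0 < κ := by positivity
  have hc : 0 < essConst β₀ := Real.exp_pos _
  have hc1 : essConst β₀ ≤ 1 := Real.exp_le_one_iff.2 (by
    have : 0 ≤ 32 * β₀ / (β₀ - 1) := by positivity
    linarith)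
  -- Raising to the power `2 / n` turns `c₀ⁿ` into `c₀ ^ 2` and the entropy gap `4 κ n` into the
  -- factor `exp (8 κ)`; the `4` bounds `2 ^ (2/n)`, coming from `1/2 ≤ M |K_f|`, for all `n ≥ 1`.
  refine ⟨essConst β₀ ^ 2, 4 * Real.exp (8 * κ), by positivity, ?_, ?_⟩
  · have h1 : essConst β₀ ^ 2 ≤ 1 := pow_le_one₀ hc.le hc1
    have h2 : 1 ≤ Real.exp (8 * κ) := Real.one_le_exp (by positivity)
    linarith
  intro n hn β hnβ hβ S V hV hpos Ω _ P _ X hX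
  obtain ⟨M, hM, hfin, hKfin, hlow, hup, hK1, hK2⟩ :=
    exists_entropy_bounds hβ₀ hn hnβ hβ hV hpos hX
  refine ⟨hfin, hKfin, ?_⟩
  set k := (volume (essentialSupport β₀ (convexDensity S V β))).toReal
  have hk : 0 ≤ k := ENNReal.toReal_nonneg
  have hn0 : (0 : ℝ) < n := by exact_mod_cast hn
  have hn1 : (1 : ℝ) ≤ n := by exact_mod_cast hn
  have hMpow : M⁻¹ ^ (2 / (n : ℝ)) = Real.exp (2 * -Real.log M / n) := by
    rw [Real.rpow_def_of_pos (by positivity), Real.log_inv]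
    congr 1; ring
  have hexp : 0 ≤ 2 / (n : ℝ) := by positivity
  constructor
  · calc essConst β₀ ^ 2 * k ^ (2 / (n : ℝ))
        = (essConst β₀ ^ n * k) ^ (2 / (n : ℝ)) := by
          rw [Real.mul_rpow (by positivity) hk, ← Real.rpow_natCast _ n, ← Real.rpow_mul hc.le,
            mul_div_cancel₀ _ hn0.ne', Real.rpow_ofNat]
      _ ≤ M⁻¹ ^ (2 / (n : ℝ)) := by
          refine Real.rpow_le_rpow (by positivity) ?_ hexp
          rw [← one_div, le_div_iff₀ hM]
          linarith
      _ = Real.exp (2 * -Real.log M / n) := hMpow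
      _ ≤ entropyPower P X := by
          rw [entropyPower]; gcongr
  · calc entropyPower P X
        ≤ Real.exp (2 * (-Real.log M + 4 * κ * n) / n) := by
          rw [entropyPower]; gcongr
      _ = Real.exp (8 * κ) * M⁻¹ ^ (2 / (n : ℝ)) := by
          rw [hMpow, ← Real.exp_add]
          congr 1; field_simp; ring
      _ ≤ Real.exp (8 * κ) * (2 * k) ^ (2 / (n : ℝ)) := by
          gcongr
          rw [← one_div, div_le_iff₀ hM]
          linarith
      _ = Real.exp (8 * κ) * (2 ^ (2 / (n : ℝ)) * k ^ (2 / (n : ℝ))) := by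
          rw [Real.mul_rpow (by norm_num) hk]
      _ ≤ Real.exp (8 * κ) * (2 ^ (2 : ℝ) * k ^ (2 / (n : ℝ))) := by
          gcongr
          · norm_num
          · exact div_le_self (by norm_num) hn1
      _ = 4 * Real.exp (8 * κ) * k ^ (2 / (n : ℝ)) := by
          norm_num; ring
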